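/- Let $\mathcal{C}$ be an abelian category. An allowable class $E$ in $\mathcal{C}$ is a collection of short exact sequences in $\mathcal{C}$ that is closed under isomorphism of short exact sequences and contains every short exact sequence in which at least one object is zero. A monomorphism $f\colon M\to N$ is an $E$-monomorphism if $0\to M\to N\to \operatorname{coker} f\to 0$ is in $E$, and an epimorphism $g\colon M\to N$ is an $E$-epimorphism if $0\to\ker g\to M\to N\to 0$ is in $E$. An object is $E$-projective if every map out of it lifts over every $E$-epimorphism, and $E$-injective if every map into it extends along every $E$-monomorphism. There are enough $E$-projectives (respectively, enough $E$-injectives) if every object $X$ admits an $E$-epimorphism $P\to X$ with $P$ $E$-projective (respectively, an $E$-monomorphism $X\to I$ with $I$ $E$-injective). The class $E$ has sectile epics if $g$ is an $E$-epimorphism whenever $g\circ f$ is, and has retractile monics if $f$ is an $E$-monomorphism whenever $g\circ f$ is. Two maps $f,g\colon M\to N$ are $E$-stably equivalent, written $f\simeq g$, if $f-g$ factors through an $E$-projective object; a map $f\colon M\to N$ is an $E$-stable equivalence if there is a map $h\colon N\to M$ with $f\circ h\simeq \mathrm{id}_N$ and $h\circ f\simeq\mathrm{id}_M$. A weak Waldhausen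 category is a category equipped with a pair of subcategories $\mathrm{cof}(\mathcal{C})$ (the cofibrations) and $\mathrm{we}(\mathcal{C})$ (the weak equivalences), each containing all identity maps. An allowable class $E$ in an abelian category $\mathcal{C}$ with such a structure is allowable for $\mathcal{C}$ if $\mathrm{we}(\mathcal{C})$ is the class of $E$-stable equivalences and $\mathrm{cof}(\mathcal{C})$ is the class of $E$-monomorphisms; $\mathcal{C}$ is a weak Waldhausen abelian category if such an $E$ exists. **Corollary.** Let $\mathcal{C}$ be a weak Waldhausen abelian category and let $E$ be a class allowable for $\mathcal{C}$. Suppose that $\mathcal{C}$ has enough $E$-projectives and enough $E$-injectives, that $E$ has sectile epics and retractile monics, and that every $E$-projective object is $E$-injective. Then $\mathcal{C}$ satisfies Waldhausen's axiom **Weq 2**: for every commutative diagram $$\begin{array}{ccccc} X' & \leftarrow & Y' & \rightarrow & Z' \\ \downarrow & & \downarrow & & \downarrow \\ X & \leftarrow & Y & \rightarrow & Z \end{array}$$ in $\mathcal{C}$ in which $Y'\to X'$ and $Y\to X$ are cofibrations and all three vertical maps are weak equivalences, the induced map of pushouts $X'\coprod_{Y'}Z'\to X\coprod_Y Z$ is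 a weak equivalence. -/

import Mathlib

open CategoryTheory CategoryTheory.Limits

universe v u

/-- An allowable class in an abelian category `C`: a collection of short exact sequences, closed
under isomorphism of short exact sequences, and containing every short exact sequence in which at
least one of the three objects is zero. -/
structure AllowableClass (C : Type u) [Category.{v} C] [Abelian C] where
  /-- The members of the class. -/
  mem : ShortComplex C → Prop
  shortExact : ∀ S : ShortComplex C, mem S → S.ShortExact
  mem_of_iso : ∀ S T : ShortComplex C, Nonempty (S ≅ T) → mem S → mem T
  mem_of_isZero : ∀ S : ShortComplex C, S.ShortExact →
    (IsZero S.X₁ ∨ IsZero S.X₂ ∨ IsZero S.X₃) → mem S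

namespace AllowableClass

variable {C : Type u} [Category.{v} C] [Abelian C] (E : AllowableClass C)

/-- The `E`-monomorphisms: monomorphisms `f : M ⟶ N` such that `0 ⟶ M ⟶ N ⟶ coker f ⟶ 0` is in
`E`. -/
def monos : MorphismProperty C := fun _ _ f =>
  Mono f ∧ E.mem (ShortComplex.mk f (cokernel.π f) (cokernel.condition f))

/-- The `E`-epimorphisms: epimorphisms `g : M ⟶ N` such that `0 ⟶ ker g ⟶ M ⟶ N ⟶ 0` is in
`E`. -/
def epis : MorphismProperty C := fun _ _ g =>
  Epi g ∧ E.mem (ShortComplex.mk (kernel.ι g) g (kernel.condition g))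

/-- `X` is `E`-projective if every map out of `X` lifts over every `E`-epimorphism. -/
def IsProjective (X : C) : Prop :=
  ∀ ⦃M N : C⦄ (f : M ⟶ N), E.epis f → ∀ g : X ⟶ N, ∃ l : X ⟶ M, l ≫ f = g

/-- `X` is `E`-injective if every map into `X` extends along every `E`-monomorphism. -/
def IsInjective (X : C) : Prop :=
  ∀ ⦃M N : C⦄ (f : M ⟶ N), E.monos f → ∀ g : M ⟶ X, ∃ l : N ⟶ X, f ≫ l = g

/-- Every object is the target of an `E`-epimorphism from an `E`-projective object. -/
def EnoughProjectives : Prop :=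
  ∀ X : C, ∃ (P : C) (p : P ⟶ X), E.IsProjective P ∧ E.epis p

/-- Every object is the source of an `E`-monomorphism into an `E`-injective object. -/
def EnoughInjectives : Prop :=
  ∀ X : C, ∃ (I : C) (i : X ⟶ I), E.IsInjective I ∧ E.monos i

/-- If a composite `M ⟶ N ⟶ L` is an `E`-monomorphism, then so is its first map `M ⟶ N`. -/
def HasRetractileMonics : Prop :=
  ∀ ⦃M N L : C⦄ (f : M ⟶ N) (g : N ⟶ L), E.monos (f ≫ g) → E.monos f

/-- If a composite `M ⟶ N ⟶ L` is an `E`-epimorphism, then so is its last map `N ⟶ L`. -/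
def HasSectileEpics : Prop :=
  ∀ ⦃M N L : C⦄ (f : M ⟶ N) (g : N ⟶ L), E.epis (f ≫ g) → E.epis g

/-- Two parallel morphisms are `E`-stably equivalent if their difference factors through an
`E`-projective object. -/
def StablyEquivalent {M N : C} (f g : M ⟶ N) : Prop :=
  ∃ (P : C) (a : M ⟶ P) (b : P ⟶ N), E.IsProjective P ∧ a ≫ b = f - g

/-- The `E`-stable equivalences: morphisms with a two-sided inverse up to `E`-stable equivalence
of morphisms. -/
def stableEquivalences : MorphismProperty C := fun M N f =>
  ∃ h : N ⟶ M, E.StablyEquivalent (h ≫ f) (𝟙 N) ∧ E.StablyEquivalent (f ≫ h) (𝟙 M)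

end AllowableClass

/-- A weak Waldhausen category structure on `C`: a pair of subcategories (cofibrations and weak
equivalences), each containing all the identity morphisms of `C`. A wide subcategory is a class of
morphisms that contains the identities and is stable under composition. -/
structure WeakWaldhausenStructure (C : Type u) [Category.{v} C] where
  /-- The cofibrations. -/
  cof : MorphismProperty C
  /-- The weak equivalences. -/
  we : MorphismProperty C
  cof_isMultiplicative : cof.IsMultiplicative
  we_isMultiplicative : we.IsMultiplicative

namespace WeakWaldhausenStructure

/-- The allowable class `E` is allowable for the weak Waldhausen structure `W` if the weak
equivalences are the `E`-stable equivalences and the cofibrations are the `E`-monomorphisms. -/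
def IsAllowable {C : Type u} [Category.{v} C] [Abelian C]
    (W : WeakWaldhausenStructure C) (E : AllowableClass C) : Prop :=
  W.we = E.stableEquivalences ∧ W.cof = E.monos

/-- Waldhausen's axiom Weq 2: for every commutative diagram with rows `X' ⟵ Y' ⟶ Z'` and
`X ⟵ Y ⟶ Z`, with `Y' ⟶ X'` and `Y ⟶ X` cofibrations and with the three vertical maps weak
equivalences, the induced map from the pushout `P'` of the first row to the pushout `P` of the
second row is a weak equivalence. -/
def Weq2 {C : Type u} [Category.{v} C] (W : WeakWaldhausenStructure C) : Prop :=
  ∀ ⦃X' Y' Z' X Y Z : C⦄ (i' : Y' ⟶ X') (j' : Y' ⟶ Z') (i : Y ⟶ X) (j : Y ⟶ Z)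
    (a : X' ⟶ X) (b : Y' ⟶ Y) (c : Z' ⟶ Z)
    (hi : i' ≫ a = b ≫ i) (hj : j' ≫ c = b ≫ j),
    W.cof i' → W.cof i → W.we a → W.we b → W.we c →
    ∀ ⦃P' P : C⦄ (l' : X' ⟶ P') (r' : Z' ⟶ P') (l : X ⟶ P) (r : Z ⟶ P)
      (h' : IsPushout i' j' l' r') (h : IsPushout i j l r),
      W.we (h'.desc (a ≫ l) (c ≫ r) (by
        rw [← Category.assoc, hi, ← Category.assoc, hj, Category.assoc, Category.assoc, h.w]))

end WeakWaldhausenStructure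

/-!
Stable equivalence of morphisms is a congruence, and the `E`-stable equivalences are the morphisms
that become invertible in the quotient category (`stableEquivalences_iff_isIso`). They therefore
compose and satisfy two-out-of-three.

The gluing property rests on a normal form. A stable equivalence that is an `E`-epimorphism has a
section `s` such that `𝟙 - f ≫ s` factors through a projective killed by `f`
(`isStableRetraction_of_epis`): an inverse up to stable equivalence can be corrected by lifting the
error term over `f`. An arbitrary stable equivalence `f : M ⟶ N` takes this form after a projective
with an `E`-epimorphism onto `N` is added to `M` (`exists_isStableRetraction`, which uses sectile epics).

Of a cofibration only this is needed: maps from its source to projectives extend to its target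
(`ExtendsToProjectives`). Projectives being injective, every `E`-monomorphism has this property,
and the property is inherited by pushouts. For such an `i : Y ⟶ X`, two statements follow by writing
down explicit inverses for stable retractions and then adding projective summands:

* the pushout along `i` of a stable equivalence `Y ⟶ Z` is a stable equivalence
  (`stableEquivalences_pushout`);
* a stable equivalence `X' ⟶ X` under `Y` induces a stable equivalence of pushouts along any
  `Y ⟶ Z` (`stableEquivalences_pushout_of_under`).

The map `X' ∐_{Y'} Z' ⟶ X ∐_Y Z` factors through `X' ∐_{Y'} Z`. Its first factor is the pushout of
`Z' ⟶ Z` along the map `Z' ⟶ X' ∐_{Y'} Z'`, which inherits the extension property. Its second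
factor is induced by `X' ∐_{Y'} Y ⟶ X` under `Y`, which is a stable equivalence by
two-out-of-three.
-/

namespace AllowableClass

variable {C : Type u} [Category.{v} C] [Abelian C] (E : AllowableClass C)

/-! ### The stable category -/

variable {E} in
lemma IsProjective.biprod {P Q : C} (hP : E.IsProjective P) (hQ : E.IsProjective Q) :
    E.IsProjective (P ⊞ Q) := by
  intro M N f hf g
  obtain ⟨p, hp⟩ := hP f hf (biprod.inl ≫ g)
  obtain ⟨q, hq⟩ := hQ f hf (biprod.inr ≫ g)
  exact ⟨biprod.desc p q, by ext <;> simp [hp, hq]⟩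

lemma isProjective_of_isZero {P : C} (hP : IsZero P) : E.IsProjective P :=
  fun _ _ _ _ _ => ⟨0, hP.eq_of_src _ _⟩

/-- Stable equivalence of parallel morphisms, as a relation on hom-sets. -/
def stableHomRel : HomRel C := fun _ _ f g => E.StablyEquivalent f g

instance : Congruence E.stableHomRel where
  equivalence :=
    { refl := fun f => ⟨_, 0, 0, E.isProjective_of_isZero (isZero_zero C), by simp⟩
      symm := by
        rintro f g ⟨P, a, b, hP, h⟩
        exact ⟨P, -a, b, hP, by simp [h]⟩
      trans := by
        rintro f g k ⟨P, a, b, hP, h⟩ ⟨Q, c, d, hQ, h'⟩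
        exact ⟨P ⊞ Q, biprod.lift a c, biprod.desc b d, hP.biprod hQ, by
          simp [biprod.lift_desc, h, h']⟩ }
  comp_left := by
    rintro M N L f g k ⟨P, a, b, hP, h⟩
    exact ⟨P, f ≫ a, b, hP, by simp [h]⟩
  comp_right := by
    rintro M N L f g k ⟨P, a, b, hP, h⟩
    exact ⟨P, a, b ≫ k, hP, by rw [← Category.assoc, h, Preadditive.sub_comp]⟩

lemma stableEquivalences_iff_isIso {M N : C} (f : M ⟶ N) :
    E.stableEquivalences f ↔ IsIso ((Quotient.functor E.stableHomRel).map f) := by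
  constructor
  · rintro ⟨h, hN, hM⟩
    refine ⟨(Quotient.functor E.stableHomRel).map h, ?_, ?_⟩
    · rw [← Functor.map_comp, ← CategoryTheory.Functor.map_id]
      exact CategoryTheory.Quotient.sound _ hM
    · rw [← Functor.map_comp, ← CategoryTheory.Functor.map_id]
      exact CategoryTheory.Quotient.sound _ hN
  · rintro ⟨g, hM, hN⟩
    obtain ⟨h, rfl⟩ := (Quotient.functor E.stableHomRel).map_surjective g
    rw [← Functor.map_comp, ← CategoryTheory.Functor.map_id] at hM hN
    exact ⟨h, (Quotient.functor_map_eq_iff E.stableHomRel _ _).1 hN,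
      (Quotient.functor_map_eq_iff E.stableHomRel _ _).1 hM⟩

variable {E} in
lemma stableEquivalences_comp {M N L : C} {f : M ⟶ N} {g : N ⟶ L}
    (hf : E.stableEquivalences f) (hg : E.stableEquivalences g) :
    E.stableEquivalences (f ≫ g) := by
  rw [stableEquivalences_iff_isIso] at *
  rw [Functor.map_comp]
  infer_instance

variable {E} in
lemma stableEquivalences_of_comp_left {M N L : C} {f : M ⟶ N} {g : N ⟶ L}
    (hf : E.stableEquivalences f) (hfg : E.stableEquivalences (f ≫ g)) :
    E.stableEquivalences g := by
  rw [stableEquivalences_iff_isIso] at *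
  rw [Functor.map_comp] at hfg
  exact IsIso.of_isIso_comp_left ((Quotient.functor E.stableHomRel).map f) _

variable {E} in
lemma stableEquivalences_biprod_inl (M : C) {P : C} (hP : E.IsProjective P) :
    E.stableEquivalences (biprod.inl : M ⟶ M ⊞ P) := by
  refine ⟨biprod.fst, ⟨P, -biprod.snd, biprod.inr, hP, ?_⟩, ⟨P, 0, 0, hP, by simp⟩⟩
  rw [← biprod.total, Preadditive.neg_comp]
  abel

/-! ### Stable retractions -/

/-- A stable retraction is a split epimorphism `f` with a section `s` whose complementary
idempotent `𝟙 - f ≫ s` factors through a projective, by way of a map into the kernel of `f`.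
Equivalently, `f` is a split epimorphism with `E`-projective kernel. -/
def IsStableRetraction {M N : C} (f : M ⟶ N) : Prop :=
  ∃ (s : N ⟶ M) (P : C) (a : M ⟶ P) (b : P ⟶ M),
    E.IsProjective P ∧ s ≫ f = 𝟙 N ∧ b ≫ f = 0 ∧ f ≫ s + a ≫ b = 𝟙 M

variable {E}

/-- A stable inverse `h` of an `E`-epimorphism `f` becomes a strict section after subtracting a lift
over `f` of the factorization of `h ≫ f - 𝟙` through a projective. -/
lemma isStableRetraction_of_epis {M N : C} {f : M ⟶ N} (hf : E.stableEquivalences f)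
    (hf' : E.epis f) : E.IsStableRetraction f := by
  obtain ⟨h, ⟨P, u, v, hP, huv⟩, ⟨Q, c, d, hQ, hcd⟩⟩ := hf
  obtain ⟨w, rfl⟩ := hP f hf' v
  have hs : (h - u ≫ w) ≫ f = 𝟙 N := by
    rw [Preadditive.sub_comp, Category.assoc, huv]; abel
  have he : 𝟙 M - f ≫ (h - u ≫ w) =
      biprod.lift (f ≫ u) (-c) ≫ biprod.desc w d := by
    rw [biprod.lift_desc, Preadditive.neg_comp, hcd, Preadditive.comp_sub, Category.assoc]
    abel
  have hef : (𝟙 M - f ≫ (h - u ≫ w)) ≫ f = 0 := by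
    rw [Preadditive.sub_comp, Category.assoc, hs]; simp
  -- Composing the second map with the idempotent itself places it in the kernel of `f`.
  refine ⟨h - u ≫ w, P ⊞ Q, biprod.lift (f ≫ u) (-c),
    biprod.desc w d ≫ (𝟙 M - f ≫ (h - u ≫ w)), hP.biprod hQ, hs, ?_, ?_⟩
  · rw [Category.assoc, hef, comp_zero]
  · rw [← Category.assoc (biprod.lift _ _), ← he, Preadditive.comp_sub (_ - _), ← Category.assoc,
      hef]
    simp

/-- Every stable equivalence becomes a stable retraction once a projective summand is added to its
source: by sectile epics, a map that is an `E`-epimorphism on one summand is an `E`-epimorphism. -/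
lemma exists_isStableRetraction (enoughProj : E.EnoughProjectives) (sectile : E.HasSectileEpics)
    {M N : C} {f : M ⟶ N} (hf : E.stableEquivalences f) :
    ∃ (P : C) (p : P ⟶ N), E.IsProjective P ∧ E.IsStableRetraction (biprod.desc f p) := by
  obtain ⟨P, p, hP, hp⟩ := enoughProj N
  refine ⟨P, p, hP, isStableRetraction_of_epis ?_ (sectile biprod.inr _ (by simpa using hp))⟩
  exact stableEquivalences_of_comp_left (stableEquivalences_biprod_inl M hP) (by simpa using hf)

/-! ### Pushouts and stable equivalences -/

variable (E) in
/-- Every map from the source of `i` to an `E`-projective object extends along `i`. This is what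
remains of being an `E`-monomorphism when `E`-projectives are `E`-injective. -/
def ExtendsToProjectives {M N : C} (i : M ⟶ N) : Prop :=
  ∀ P : C, E.IsProjective P → ∀ g : M ⟶ P, ∃ l : N ⟶ P, i ≫ l = g

lemma extendsToProjectives_of_monos (proj_inj : ∀ P : C, E.IsProjective P → E.IsInjective P)
    {M N : C} {i : M ⟶ N} (hi : E.monos i) : E.ExtendsToProjectives i :=
  fun P hP g => proj_inj P hP i hi g

lemma ExtendsToProjectives.of_isPushout {X Y Z Q : C} {i : Y ⟶ X} {j : Y ⟶ Z} {l : X ⟶ Q}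
    {r : Z ⟶ Q} (hi : E.ExtendsToProjectives i) (h : IsPushout i j l r) :
    E.ExtendsToProjectives r := by
  intro P hP g
  obtain ⟨k, hk⟩ := hi P hP (j ≫ g)
  exact ⟨h.desc k g hk, h.inr_desc _ _ _⟩

/-- Adding a summand to `M` and to `N` is a pushout; pasting with this square reduces statements
about pushouts of stable equivalences to stable retractions. -/
lemma isPushout_biprod_inl {M N : C} (f : M ⟶ N) (P : C) :
    IsPushout f (biprod.inl : M ⟶ M ⊞ P) biprod.inl (biprod.map f (𝟙 P)) := by
  refine ⟨⟨by simp⟩, ⟨PushoutCocone.IsColimit.mk _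
    (fun s => biprod.desc s.inl (biprod.inr ≫ s.inr)) (fun s => by simp) (fun s => ?_)
    (fun s m h₁ h₂ => ?_)⟩⟩
  · ext
    · simp [s.condition]
    · simp
  · ext
    · simp [h₁]
    · simp [← h₂]

/-- The inverse of `l` is glued from `s ≫ i` and the endomorphism `𝟙 - a' ≫ b ≫ i` of `X`, where
`a'` extends `a` along `i`. It is a strict section of `l` because `b ≫ f = 0`. -/
lemma IsStableRetraction.pushout {X Y Z Q : C} {i : Y ⟶ X} {f : Y ⟶ Z} {l : X ⟶ Q} {r : Z ⟶ Q}
    (hf : E.IsStableRetraction f) (hi : E.ExtendsToProjectives i) (h : IsPushout i f l r) :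
    E.stableEquivalences l := by
  obtain ⟨s, P, a, b, hP, hs, hb, hab⟩ := hf
  obtain ⟨a', rfl⟩ := hi P hP a
  have w : i ≫ (𝟙 X - a' ≫ b ≫ i) = f ≫ s ≫ i := by
    have := congrArg (· ≫ i) hab
    simp only [Preadditive.add_comp, Category.assoc, Category.id_comp] at this
    rw [Preadditive.comp_sub, Category.comp_id, sub_eq_iff_eq_add, this]
  have ht : h.desc (𝟙 X - a' ≫ b ≫ i) (s ≫ i) w ≫ l = 𝟙 Q := by
    apply h.hom_ext
    · rw [h.inl_desc_assoc, Preadditive.sub_comp, Category.assoc, Category.assoc, h.w,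
        reassoc_of% hb]
      simp
    · rw [h.inr_desc_assoc, Category.assoc, h.w, reassoc_of% hs, Category.comp_id]
  refine ⟨h.desc _ _ w, ⟨P, 0, 0, hP, by simp [ht]⟩, ⟨P, -a', b ≫ i, hP, by simp⟩⟩

/-- Left properness: stable equivalences are stable under pushout along cofibrations. -/
lemma stableEquivalences_pushout (enoughProj : E.EnoughProjectives)
    (sectile : E.HasSectileEpics) {X Y Z Q : C} {i : Y ⟶ X} {f : Y ⟶ Z} {l : X ⟶ Q} {r : Z ⟶ Q}
    (hf : E.stableEquivalences f) (hi : E.ExtendsToProjectives i) (h : IsPushout i f l r) :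
    E.stableEquivalences l := by
  obtain ⟨P, p, hP, hret⟩ := exists_isStableRetraction enoughProj sectile hf
  have hi' : E.ExtendsToProjectives (biprod.map i (𝟙 P)) :=
    hi.of_isPushout (isPushout_biprod_inl i P)
  have h' : IsPushout (biprod.map i (𝟙 P)) (biprod.desc f p) (biprod.desc l (p ≫ r)) r := by
    refine IsPushout.of_top (v₁₁ := biprod.inl) (v₁₂ := biprod.inl) (by simpa using h) ?_
      (isPushout_biprod_inl i P)
    ext <;> simp [h.w]
  have := stableEquivalences_comp (stableEquivalences_biprod_inl X hP) (hret.pushout hi' h')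
  simpa using this

/-- The extension property of `i` makes it possible to choose the section of `f` under `Y`, so that
it induces a section of `q`. The complementary idempotent of the new section factors through a
projective by a map vanishing on `Y`, so it passes to the pushout as well. -/
lemma IsStableRetraction.pushout_of_under {X X' Y Z Q Q' : C} {i : Y ⟶ X} {i' : Y ⟶ X'}
    {j : Y ⟶ Z} {l : X ⟶ Q} {r : Z ⟶ Q} {l' : X' ⟶ Q'} {r' : Z ⟶ Q'} {f : X' ⟶ X} {q : Q' ⟶ Q}
    (hf : E.IsStableRetraction f) (hi : E.ExtendsToProjectives i) (h : IsPushout i j l r)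
    (h' : IsPushout i' j l' r') (hif : i' ≫ f = i) (hl : l' ≫ q = f ≫ l) (hr : r' ≫ q = r) :
    E.stableEquivalences q := by
  obtain ⟨s, P, a, b, hP, hs, hb, hab⟩ := hf
  obtain ⟨e, he⟩ := hi P hP (i' ≫ a)
  -- Correcting `s` by `e ≫ b` gives a section of `f` under `Y`.
  have hs' : i ≫ (s + e ≫ b) = i' := by
    rw [Preadditive.comp_add, reassoc_of% he, ← hif, Category.assoc, ← Preadditive.comp_add, hab,
      Category.comp_id]
  have hs'f : (s + e ≫ b) ≫ f = 𝟙 X := by simp [hs, hb]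
  have hfs' : f ≫ (s + e ≫ b) = 𝟙 X' - (a - f ≫ e) ≫ b := by
    rw [← hab]; simp; abel
  have w : i ≫ (s + e ≫ b) ≫ l' = j ≫ r' := by rw [reassoc_of% hs', h'.w]
  have w' : i' ≫ (a - f ≫ e) = j ≫ 0 := by simp [reassoc_of% hif, he]
  refine ⟨h.desc _ _ w, ⟨P, 0, 0, hP, ?_⟩, ⟨P, -h'.desc _ _ w', b ≫ l', hP, ?_⟩⟩
  · rw [zero_comp, eq_comm, sub_eq_zero]
    apply h.hom_ext
    · rw [h.inl_desc_assoc, Category.assoc, hl, reassoc_of% hs'f, Category.comp_id]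
    · rw [h.inr_desc_assoc, hr, Category.comp_id]
  · apply h'.hom_ext
    · rw [Preadditive.comp_sub, reassoc_of% hl, h.inl_desc, reassoc_of% hfs']
      simp
    · rw [Preadditive.comp_sub, reassoc_of% hr, h.inr_desc]
      simp

/-- A stable equivalence `X' ⟶ X` under `Y` induces a stable equivalence on pushouts along any
`Y ⟶ Z` if maps to projectives extend along `Y ⟶ X`; the map `Y ⟶ X'` may be arbitrary. -/
lemma stableEquivalences_pushout_of_under (enoughProj : E.EnoughProjectives)
    (sectile : E.HasSectileEpics) {X X' Y Z Q Q' : C} {i : Y ⟶ X} {i' : Y ⟶ X'}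
    {j : Y ⟶ Z} {l : X ⟶ Q} {r : Z ⟶ Q} {l' : X' ⟶ Q'} {r' : Z ⟶ Q'} {f : X' ⟶ X} {q : Q' ⟶ Q}
    (hf : E.stableEquivalences f) (hi : E.ExtendsToProjectives i) (h : IsPushout i j l r)
    (h' : IsPushout i' j l' r') (hif : i' ≫ f = i) (hl : l' ≫ q = f ≫ l) (hr : r' ≫ q = r) :
    E.stableEquivalences q := by
  obtain ⟨P, p, hP, hret⟩ := exists_isStableRetraction enoughProj sectile hf
  have h'' : IsPushout (i' ≫ biprod.inl) j (biprod.map l' (𝟙 P)) (r' ≫ biprod.inl) :=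
    h'.paste_horiz (isPushout_biprod_inl l' P).flip
  have hq : E.stableEquivalences (biprod.desc q (p ≫ l)) := by
    refine hret.pushout_of_under hi h h'' (by simpa using hif) ?_ (by simpa using hr)
    ext <;> simp [hl]
  simpa using stableEquivalences_comp (stableEquivalences_biprod_inl Q' hP) hq

end AllowableClass

/-! ### The gluing axiom -/

open AllowableClass in
theorem mainTheorem4 {C : Type u} [Category.{v} C] [Abelian C]
    (W : WeakWaldhausenStructure C) (E : AllowableClass C) (hE : W.IsAllowable E)
    (enoughProj : E.EnoughProjectives) (enoughInj : E.EnoughInjectives)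
    (sectile : E.HasSectileEpics) (retractile : E.HasRetractileMonics)
    (proj_inj : ∀ P : C, E.IsProjective P → E.IsInjective P) :
    W.Weq2 := by
  intro X' Y' Z' X Y Z i' j' i j a b c hi hj hi'c hic ha hb hc P' P l' r' l r h' h
  rw [hE.1] at ha hb hc ⊢
  rw [hE.2] at hi'c hic
  have ei' := extendsToProjectives_of_monos proj_inj hi'c
  have ei := extendsToProjectives_of_monos proj_inj hic
  have hX := IsPushout.of_hasPushout i' b
  have hQ := IsPushout.of_hasPushout i' (b ≫ j)
  have ha' : E.stableEquivalences (hX.desc a i hi) :=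
    stableEquivalences_of_comp_left (stableEquivalences_pushout enoughProj sectile hb ei' hX)
      (by simpa using ha)
  -- `X' ∐_{Y'} Z` is the pushout of `Z' ⟶ Z` along `Z' ⟶ X' ∐_{Y'} Z'`.
  have hQ₁ := IsPushout.of_top' (h₃₁ := pushout.inr i' (b ≫ j)) (v₂₁ := c)
    (by rw [hj]; exact hQ) h'
  have h₁ := stableEquivalences_pushout enoughProj sectile hc (ei'.of_isPushout h') hQ₁
  -- It is also the pushout of `Y ⟶ Z` along `Y ⟶ X' ∐_{Y'} Y`.
  have hQ₂ := IsPushout.of_top' hQ hX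
  have h₂ : E.stableEquivalences (hQ.desc (a ≫ l) r (by
      rw [reassoc_of% hi, h.w, Category.assoc])) := by
    refine stableEquivalences_pushout_of_under enoughProj sectile ha' ei h hQ₂ (by simp) ?_
      (by simp)
    apply hX.hom_ext
    · simp
    · simp [h.w]
  convert stableEquivalences_comp h₁ h₂ using 1
  apply h'.hom_ext <;> simp
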